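/- An instance $\mathcal I=(E,\mathcal D,\mathcal F)$ consists of a finite ground set $E$, a distribution $D_e$ of a nonnegative value for every $e\in E$, and a nonempty family $\mathcal F\subseteq 2^E$ of feasible sets. It is binary if every $D_e$ has support $\{0,1\}$, and $\mathcal F$ is downward-closed if every subset of a set in $\mathcal F$ is in $\mathcal F$. The elements arrive one by one in an order $\pi$; when $e$ arrives, its identity and its value $v_e$, drawn independently from $D_e$, are revealed, and an online algorithm irrevocably decides whether to select $e$. The set selected at the end must belong to $\mathcal F$, and the utility is the sum of the values of the selected elements. Algorithms may be randomized, with internal randomness independent of the values. An order-aware algorithm knows $\pi$ in advance; an order-unaware algorithm does not, so that each of its decisions depends only on the elements and values that have arrived so far (and on its internal randomness). Let $ALG_{\mathcal I}(\pi)$ denote the expected utility of an algorithm when the order is $\pi$, let $OPT_{\mathcal I,\pi}(\pi)$ be the maximal expected utility of an order-aware algorithm for the order $\pi$, and let $$\rho(\mathcal I,ALG_{\mathcal I})=\min_\pi \frac{ALG_{\mathcal I}(\pi)}{OPT_{\mathcal I,\pi}(\pi)}$$ be the order-competitive ratio. Theorem. There exists a constant $\xi>0$ such that for every integer $n>2$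 there is a binary instance $\mathcal I=(E,\mathcal D,\mathcal F)$ with $|E|=n$ and a downward-closed feasibility constraint $\mathcal F$, with $OPT_{\mathcal I,\pi}(\pi)>0$ for every arrival order $\pi$, such that every order-unaware algorithm $ALG_{\mathcal I}$, deterministic or randomized, satisfies $$\rho(\mathcal I,ALG_{\mathcal I})\le \frac{\xi\cdot\log\log n}{\log n}.$$ -/

import Mathlib

open scoped NNReal ENNReal

/-- An instance `(E, 𝒟, ℱ)` over the finite ground set `E`: every element `e` carries a distribution
`dist e` of its (nonnegative) value, and `feasible` is the nonempty family of feasible sets. -/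
structure ProphetInstance (E : Type) where
  dist : E → MeasureTheory.ProbabilityMeasure ℝ≥0
  feasible : Set (Finset E)
  feasible_nonempty : feasible.Nonempty

/-- An order of arrival: `π i` is the element that arrives at time `i`. -/
abbrev ArrivalOrder (E : Type) [Fintype E] : Type := Fin (Fintype.card E) ≃ E

namespace ProphetInstance

variable {E : Type}

/-- The support of every value distribution is `{0, 1}`. -/
def IsBinary (I : ProphetInstance E) : Prop :=
  ∀ e, (I.dist e : MeasureTheory.Measure ℝ≥0).support = {0, 1}

/-- Every subset of a feasible set is feasible. -/
def IsDownwardClosed (I : ProphetInstance E) : Prop :=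
  ∀ S ∈ I.feasible, ∀ T ⊆ S, T ∈ I.feasible

variable [Fintype E]

/-- The joint law of the values: they are independent, with `v e` distributed as `dist e`. -/
noncomputable def valueLaw (I : ProphetInstance E) : MeasureTheory.Measure (E → ℝ≥0) :=
  MeasureTheory.Measure.pi fun e => (I.dist e : MeasureTheory.Measure ℝ≥0)

end ProphetInstance

/-- A (possibly randomized) online algorithm, which may know the arrival order in advance.
Its internal randomness `ω` is drawn from the probability space `(Ω, μ)` independently of the
values; `select π ω v` is the set it has chosen at the end, if the order is `π`, the random seed is
`ω` and the values are `v`. The field `online` says that whether the element arriving at time `t` is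
chosen is decided on its arrival: it depends only on the values revealed up to time `t` (and on `π`
and `ω`). A deterministic algorithm is one whose `Ω` is a single point. -/
structure OnlineAlgorithm {E : Type} [Fintype E] (I : ProphetInstance E) where
  Ω : Type
  [measurableSpace : MeasurableSpace Ω]
  μ : MeasureTheory.Measure Ω
  [isProbabilityMeasure : MeasureTheory.IsProbabilityMeasure μ]
  select : ArrivalOrder E → Ω → (E → ℝ≥0) → Finset E
  measurable_select : ∀ π e, MeasurableSet {p : Ω × (E → ℝ≥0) | e ∈ select π p.1 p.2}
  feasible_select : ∀ π ω v, select π ω v ∈ I.feasible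
  online : ∀ (π : ArrivalOrder E) (ω : Ω) (v v' : E → ℝ≥0) (t : Fin (Fintype.card E)),
    (∀ i ≤ t, v (π i) = v' (π i)) → (π t ∈ select π ω v ↔ π t ∈ select π ω v')

attribute [instance] OnlineAlgorithm.measurableSpace OnlineAlgorithm.isProbabilityMeasure

namespace OnlineAlgorithm

variable {E : Type} [Fintype E] {I : ProphetInstance E}

/-- The algorithm does not know the order of the future arrivals: the decision at time `t` is the
same under two orders that agree up to time `t`. Together with `online`, each decision is a function
of the seed and of the sequence of elements and values that have arrived so far. -/
def IsOrderUnaware (A : OnlineAlgorithm I) : Prop :=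
  ∀ (π π' : ArrivalOrder E) (ω : A.Ω) (v : E → ℝ≥0) (t : Fin (Fintype.card E)),
    (∀ i ≤ t, π i = π' i) → (π t ∈ A.select π ω v ↔ π t ∈ A.select π' ω v)

/-- The expected utility `ALG(π)`: the expectation, over the values and the internal randomness, of
the sum of the values of the selected elements when the arrival order is `π`. -/
noncomputable def utility (A : OnlineAlgorithm I) (π : ArrivalOrder E) : ℝ≥0∞ :=
  ∫⁻ p, ∑ e ∈ A.select π p.1 p.2, (p.2 e : ℝ≥0∞) ∂(A.μ.prod I.valueLaw)

end OnlineAlgorithm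

/-- The optimal expected utility `OPT_π(π)` of an order-aware algorithm for the arrival order `π`. -/
noncomputable def ProphetInstance.opt {E : Type} [Fintype E] (I : ProphetInstance E)
    (π : ArrivalOrder E) : ℝ≥0∞ :=
  ⨆ A : OnlineAlgorithm I, A.utility π

/-- The order-competitive ratio `min_π ALG(π) / OPT_π(π)`; it is meaningful when `OPT_π(π)` is
positive (and finite) for every `π`. -/
noncomputable def OnlineAlgorithm.orderCompetitiveRatio {E : Type} [Fintype E]
    {I : ProphetInstance E} (A : OnlineAlgorithm I) : ℝ≥0∞ :=
  ⨅ π : ArrivalOrder E, A.utility π / I.opt π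

/-! The hard instance is a tree of depth `d` in which every node has `d * d` children, indexed by
two labels `a` and `c`. Values are `1` with probability `1 / (2d)`, and feasible sets lie on
root-to-leaf paths. A uniformly random hidden sequence `θ` fixes the order: as long as the path
above follows `θ` in its `c`-labels, children arrive level by level, grouped by `a`, with all values
of `c` in the same group. Everything below a wrong `c`-label arrives at the end, deepest level
first.

Knowing `θ`, one can take at every level the first child of value `1` with `c = θ j`. One of the `d`
candidates has value `1` with probability at least `1 / 3`, so the optimum is at least `d / 3`
(`le_opt_hiddenOrder`).

Without `θ`, the arrivals up to a node of level `j` above which no label is wrong reveal nothing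
about `θ j` (`hiddenOrder_agree`). Hence a node with all labels right is selected at level `j` with
probability at most `1 / d`, which contributes at most `1` over all levels
(`mul_sum_card_goodAt_le`). A path has at most one first wrong node. Among the late nodes, the
deepest selected one counts at most `1`; the others are ancestors of a node selected before their
values are seen, so at most `d` values of mean `1 / (2d)` remain (`sum_lintegral_marked_le`). The
average utility is thus at most `4` (`sum_utility_le`), and some `θ` gives ratio at most `12 / d`.
The tree needs `d ^ (2d + 1)` elements, which allows `d` of order `log n / log log n`. -/

namespace HiddenTree

open MeasureTheory

/-! ### Independence in product spaces -/

section ProductMeasure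

variable {ι : Type*} [Fintype ι] [DecidableEq ι]

/-- In a product space, functions of disjoint sets of coordinates are uncorrelated. -/
lemma lintegral_pi_mul_of_dependsOn {X : ι → Type*} [∀ i, MeasurableSpace (X i)]
    [∀ i, Inhabited (X i)] (μ : ∀ i, Measure (X i)) [∀ i, IsProbabilityMeasure (μ i)]
    (S T : Finset ι) (hST : Disjoint S T)
    {f g : (∀ i, X i) → ℝ≥0∞} (hf : Measurable f) (hg : Measurable g)
    (hfS : DependsOn f S) (hgT : DependsOn g T) :
    ∫⁻ v, f v * g v ∂Measure.pi μ = (∫⁻ v, f v ∂Measure.pi μ) * ∫⁻ v, g v ∂Measure.pi μ := by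
  have ind := (ProbabilityTheory.iIndepFun_pi (μ := μ) (X := fun _ x => x)
    (fun i => aemeasurable_id)).indepFun_finset S T hST (fun i => measurable_pi_apply i)
  -- Filling the missing coordinates with default values factors `f` and `g` through the
  -- restrictions to `S` and `T`, which are independent.
  let ext : ∀ (U : Finset ι), (∀ i : U, X i) → ∀ i, X i :=
    fun U z i => if h : i ∈ U then z ⟨i, h⟩ else default
  have hext : ∀ U, Measurable (ext U) := by
    intro U
    refine measurable_pi_lambda _ fun i => ?_
    by_cases h : i ∈ U
    · simpa [ext, h] using measurable_pi_apply (⟨i, h⟩ : U)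
    · simp [ext, h]
  have key := ind.comp (hf.comp (hext S)) (hg.comp (hext T))
  have e1 : (f ∘ ext S) ∘ (fun (a : ∀ i, X i) (i : S) => a i) = f := by
    funext v
    exact hfS fun i hi => by simp [ext, Finset.mem_coe.1 hi]
  have e2 : (g ∘ ext T) ∘ (fun (a : ∀ i, X i) (i : T) => a i) = g := by
    funext v
    exact hgT fun i hi => by simp [ext, Finset.mem_coe.1 hi]
  rw [e1, e2] at key
  exact ProbabilityTheory.lintegral_mul_eq_lintegral_mul_lintegral_of_indepFun hf hg key

end ProductMeasure

/-! ### Bernoulli values -/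

section Bernoulli

/-- The Bernoulli distribution on `{0, 1}` with success probability `p`. -/
noncomputable def bernoulli (p : ℝ≥0∞) : Measure ℝ≥0 :=
  (1 - p) • Measure.dirac 0 + p • Measure.dirac 1

variable {p : ℝ≥0∞}

lemma isProbabilityMeasure_bernoulli (hp : p ≤ 1) : IsProbabilityMeasure (bernoulli p) := by
  constructor
  simp [bernoulli, tsub_add_cancel_of_le hp]

lemma support_bernoulli (hp0 : p ≠ 0) (hp1 : p < 1) :
    (bernoulli p).support = {0, 1} := by
  have h1 : 1 - p ≠ 0 := (tsub_pos_of_lt hp1).ne'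
  have hd : ∀ a x : ℝ≥0, ∀ q : ℝ≥0∞, q ≠ 0 →
      (x ∈ (q • Measure.dirac a : Measure ℝ≥0).support ↔ x = a) := by
    intro a x q hq
    constructor
    · intro h
      by_contra hne
      rw [Measure.mem_support_iff_forall] at h
      have := h {a}ᶜ (isOpen_compl_singleton.mem_nhds hne)
      simp at this
    · rintro rfl
      rw [Measure.mem_support_iff_forall]
      intro U hU
      simp [Measure.dirac_apply_of_mem (mem_of_mem_nhds hU), pos_iff_ne_zero, hq]
  ext x
  simp only [bernoulli, Measure.support_add, Set.mem_union, hd _ _ _ h1, hd _ _ _ hp0,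
    Set.mem_insert_iff, Set.mem_singleton_iff]

lemma lintegral_bernoulli : ∫⁻ x : ℝ≥0, (x : ℝ≥0∞) ∂bernoulli p = p := by
  simp [bernoulli]

lemma bernoulli_compl_one : bernoulli p {1}ᶜ = 1 - p := by
  simp [bernoulli]

lemma bernoulli_ae : ∀ᵐ x ∂bernoulli p, x ≤ 1 := by
  rw [ae_iff]
  have : ({a : ℝ≥0 | ¬a ≤ 1}) = Set.Ioi 1 := by ext; simp
  rw [this]
  simp [bernoulli]

end Bernoulli

/-! ### Arrival orders defined by keys -/

section KeyOrder

variable {E K : Type} [Fintype E] [LinearOrder K]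

/-- The arrival order in which the elements arrive by increasing key. -/
noncomputable def keyOrder (key : E → K) (hkey : Function.Injective key) : ArrivalOrder E :=
  letI := LinearOrder.lift' key hkey
  (monoEquivOfFin E rfl).toEquiv

lemma keyOrder_le_iff (key : E → K) (hkey : Function.Injective key) (i j) :
    key (keyOrder key hkey i) ≤ key (keyOrder key hkey j) ↔ i ≤ j :=
  letI := LinearOrder.lift' key hkey
  (monoEquivOfFin E rfl).le_iff_le

lemma keyOrder_symm_le_iff (key : E → K) (hkey : Function.Injective key) (e f) :
    (keyOrder key hkey).symm e ≤ (keyOrder key hkey).symm f ↔ key e ≤ key f := by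
  rw [← keyOrder_le_iff key hkey]; simp

/-- Expresses arrival times through key comparisons alone, so that the orders of two different keys
can be compared. -/
lemma card_filter_key_lt (key : E → K) (hkey : Function.Injective key) (e : E) :
    (Finset.univ.filter fun x => key x < key e).card = ((keyOrder key hkey).symm e : ℕ) := by
  rw [← Fin.card_Iio]
  refine Finset.card_bij' (fun x _ => (keyOrder key hkey).symm x)
    (fun i _ => keyOrder key hkey i) ?_ ?_ (by simp) (by simp)
  · intro x hx
    simp only [Finset.mem_filter, Finset.mem_univ, true_and] at hx
    rw [Finset.mem_Iio, ← not_le, keyOrder_symm_le_iff, not_le]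
    exact hx
  · intro i hi
    rw [Finset.mem_Iio, ← not_le, ← keyOrder_le_iff key hkey, not_le] at hi
    simpa using hi

/-- Two key functions that agree on the elements up to `w` induce the same order up to `w`. -/
lemma keyOrder_agree (key key' : E → K) (hkey : Function.Injective key)
    (hkey' : Function.Injective key') (w : E)
    (h : ∀ e, key e ≤ key w → key' e = key e) (h' : ∀ e, key' e ≤ key' w → key e = key' e)
    (i) (hi : i ≤ (keyOrder key hkey).symm w) :
    keyOrder key hkey i = keyOrder key' hkey' i := by
  obtain ⟨e, rfl⟩ := (keyOrder key hkey).symm.surjective i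
  rw [keyOrder_symm_le_iff] at hi
  rw [Equiv.apply_symm_apply, eq_comm, ← Equiv.eq_symm_apply]
  apply Fin.ext
  rw [← card_filter_key_lt, ← card_filter_key_lt]
  congr 1
  ext x
  have hw := h w le_rfl
  have he := h e hi
  simp only [Finset.mem_filter, Finset.mem_univ, true_and, he]
  constructor
  · intro hx
    rwa [h x (hx.le.trans hi)]
  · intro hx
    rwa [h' x (hx.le.trans (hi.trans hw.ge))]

end KeyOrder

/-! ### The tree and its hidden orders -/

/-- The ground set: triples of a level and the labels of a tree node, padded with extra elements. -/
abbrev Ground (d m : ℕ) : Type := (Fin d × (Fin d → Fin d) × (Fin d → Fin d)) ⊕ Fin m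

variable {d m : ℕ}

/-- The labels up to level `j`, the others being reset. -/
def trunc [NeZero d] (j : Fin d) (a : Fin d → Fin d) : Fin d → Fin d := fun i => if i ≤ j then a i else 0

/-- The node at level `j` on the path towards the leaf with labels `a` and `c`. -/
def node [NeZero d] (m : ℕ) (j : Fin d) (a c : Fin d → Fin d) : Ground d m := Sum.inl (j, trunc j a, trunc j c)

lemma trunc_eq_iff [NeZero d] {j : Fin d} {a a' : Fin d → Fin d} :
    trunc j a = trunc j a' ↔ ∀ i ≤ j, a i = a' i := by
  constructor
  · intro h i hi
    simpa [trunc, hi] using congrFun h i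
  · intro h
    funext i
    by_cases hi : i ≤ j
    · simp [trunc, hi, h i hi]
    · simp [trunc, hi]

lemma node_eq_iff [NeZero d] {j j' : Fin d} {a c a' c' : Fin d → Fin d} :
    node m j a c = node m j' a' c' ↔ j = j' ∧ ∀ i ≤ j, a i = a' i ∧ c i = c' i := by
  constructor
  · intro h
    simp only [node, Sum.inl.injEq, Prod.mk.injEq] at h
    obtain ⟨rfl, h1, h2⟩ := h
    rw [trunc_eq_iff] at h1 h2
    exact ⟨rfl, fun i hi => ⟨h1 i hi, h2 i hi⟩⟩
  · rintro ⟨rfl, h⟩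
    simp only [node, Sum.inl.injEq, Prod.mk.injEq, true_and]
    exact ⟨trunc_eq_iff.2 fun i hi => (h i hi).1, trunc_eq_iff.2 fun i hi => (h i hi).2⟩

/-- The phase in which an element arrives if the hidden labels are `θ`. Nodes whose proper ancestors
all have the hidden labels come level by level downwards; then the other nodes come upwards. -/
def phase (θ : Fin d → Fin d) : Ground d m → ℕ
  -- The test stops short of level `j`, so siblings that differ only in `c j` share a phase whether
  -- or not `c j = θ j`. Early phases stay below `d * d`.
  | Sum.inl (j, a, c) => if ∀ i < j, c i = θ i then j * d + a j else d * d + (d - j)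
  | Sum.inr _ => 0

/-- A proper ancestor of the node does not have the hidden label. -/
def Late (θ : Fin d → Fin d) : Ground d m → Prop
  | Sum.inl (j, _, c) => ¬ ∀ i < j, c i = θ i
  | Sum.inr _ => False

lemma phase_of_late {θ : Fin d → Fin d} {j a c} (h : Late θ (Sum.inl (j, a, c) : Ground d m)) :
    phase θ (Sum.inl (j, a, c) : Ground d m) = d * d + (d - j) := by
  simp only [Late] at h
  simp [phase, h]

lemma phase_of_not_late {θ : Fin d → Fin d} {j a c}
    (h : ¬ Late θ (Sum.inl (j, a, c) : Ground d m)) :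
    phase θ (Sum.inl (j, a, c) : Ground d m) = j * d + a j := by
  simp only [Late, not_not] at h
  simp only [phase]
  rw [if_pos h]

lemma late_node_iff [NeZero d] {θ : Fin d → Fin d} {j : Fin d} {a c : Fin d → Fin d} :
    Late θ (node m j a c) ↔ ∃ i < j, c i ≠ θ i := by
  simp only [Late, node, not_forall, exists_prop]
  refine exists_congr fun i => and_congr_right fun hi => ?_
  simp [trunc, hi.le]

lemma add_lt_mul_self (j a : Fin d) : (j : ℕ) * d + a < d * d := by
  have := j.2
  have := a.2
  nlinarith

/-- The arrival key: the phase, with ties broken arbitrarily. -/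
noncomputable def arrivalKey (θ : Fin d → Fin d) (e : Ground d m) : ℕ ×ₗ ℕ :=
  toLex (phase θ e, (Fintype.equivFin (Ground d m) e : ℕ))

lemma arrivalKey_injective (θ : Fin d → Fin d) :
    Function.Injective (arrivalKey θ : Ground d m → ℕ ×ₗ ℕ) := by
  intro e f h
  simp only [arrivalKey, EmbeddingLike.apply_eq_iff_eq, Prod.mk.injEq] at h
  exact (Fintype.equivFin (Ground d m)).injective (Fin.ext h.2)

/-- The arrival order with hidden labels `θ`. -/
noncomputable def hiddenOrder (m : ℕ) (θ : Fin d → Fin d) : ArrivalOrder (Ground d m) :=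
  keyOrder (arrivalKey θ) (arrivalKey_injective θ)

lemma arrivalKey_le_of_phase_lt {θ : Fin d → Fin d} {e f : Ground d m}
    (h : phase θ e < phase θ f) : arrivalKey θ e ≤ arrivalKey θ f := by
  rw [arrivalKey, arrivalKey, Prod.Lex.toLex_le_toLex]
  exact Or.inl h

lemma phase_le_of_arrivalKey_le {θ : Fin d → Fin d} {e f : Ground d m}
    (h : arrivalKey θ e ≤ arrivalKey θ f) : phase θ e ≤ phase θ f := by
  rw [arrivalKey, arrivalKey, Prod.Lex.toLex_le_toLex] at h
  rcases h with h | h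
  · exact h.le
  · exact h.1.le

lemma hiddenOrder_symm_lt {θ : Fin d → Fin d} {e f : Ground d m}
    (h : phase θ e < phase θ f) : (hiddenOrder m θ).symm e < (hiddenOrder m θ).symm f := by
  rw [← not_le, hiddenOrder, keyOrder_symm_le_iff]
  exact fun h' => absurd (phase_le_of_arrivalKey_le h') (not_le.2 h)

/-- If `θ` and `θ'` agree above level `j`, and `w` at level `j` is not late, then the orders agree up
to the arrival of `w`. -/
lemma hiddenOrder_agree {θ θ' : Fin d → Fin d} {j : Fin d} (hθ : ∀ i < j, θ i = θ' i) {a c}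
    (hw : ¬ Late θ (Sum.inl (j, a, c) : Ground d m)) (t)
    (ht : t ≤ (hiddenOrder m θ).symm (Sum.inl (j, a, c))) :
    hiddenOrder m θ t = hiddenOrder m θ' t := by
  have aux : ∀ θ θ' : Fin d → Fin d, (∀ i < j, θ i = θ' i) →
      ¬ Late θ (Sum.inl (j, a, c) : Ground d m) → ∀ e : Ground d m,
      arrivalKey θ e ≤ arrivalKey θ (Sum.inl (j, a, c) : Ground d m) → arrivalKey θ' e = arrivalKey θ e := by
    intro θ θ' hθ hw e he
    have hle := phase_le_of_arrivalKey_le he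
    rw [phase_of_not_late hw] at hle
    have hlt := add_lt_mul_self j (a j)
    -- The tie-breaker does not involve `θ`, so only phases matter. Elements arriving no later than
    -- `w` are padding or non-late nodes of level at most `j`, whose phase sees `θ` only above level
    -- `j`.
    suffices phase θ' e = phase θ e by rw [arrivalKey, this]; rfl
    rcases e with ⟨j', a', c'⟩ | x
    · by_cases hl : Late θ (Sum.inl (j', a', c') : Ground d m)
      · rw [phase_of_late hl] at hle
        omega
      · rw [phase_of_not_late hl] at hle ⊢
        have hjj : j' ≤ j := by
          by_contra hcon
          have h1 : (j : ℕ) + 1 ≤ j' := by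
            have := not_le.1 hcon
            exact this
          have h2 := (a j).2
          nlinarith
        apply phase_of_not_late
        simp only [Late, not_not] at hl ⊢
        intro i hi
        rw [hl i hi, hθ i (lt_of_lt_of_le hi hjj)]
    · rfl
  have hw' : ¬ Late θ' (Sum.inl (j, a, c) : Ground d m) := by
    simp only [Late, not_not] at hw ⊢
    intro i hi
    rw [hw i hi, hθ i hi]
  exact keyOrder_agree _ _ _ _ _ (aux θ θ' hθ hw) (aux θ' θ (fun i hi => (hθ i hi).symm) hw') t ht

/-- Resampling one coordinate preserves the uniform law: exchanging the old label with the new one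
is an involution on pairs `(θ, c)`. -/
lemma sum_sum_update {d : ℕ} (j : Fin d) (g : (Fin d → Fin d) → ℕ) :
    ∑ θ, ∑ c, g (Function.update θ j c) = d * ∑ θ, g θ := by
  rw [← Fintype.sum_prod_type']
  let σ : (Fin d → Fin d) × Fin d → (Fin d → Fin d) × Fin d :=
    fun q => (Function.update q.1 j q.2, q.1 j)
  have hσ : Function.Involutive σ := by
    rintro ⟨θ, c⟩
    simp [σ]
  rw [Fintype.sum_equiv hσ.toPerm (fun q => g (Function.update q.1 j q.2)) (fun q => g q.1)
    (fun q => rfl), Fintype.sum_prod_type, Finset.mul_sum]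
  simp

/-! ### The binary instance -/

/-- The set of elements with value `1`. -/
noncomputable def ones (v : Ground d m → ℝ≥0) : Ground d m → Bool := fun e => decide (v e = 1)

lemma measurable_ones : Measurable (ones : (Ground d m → ℝ≥0) → Ground d m → Bool) :=
  measurable_pi_lambda _ fun e =>
    measurable_to_bool (by
      have : (fun v : Ground d m → ℝ≥0 => ones v e) ⁻¹' {true} = (fun v => v e) ⁻¹' {1} := by
        ext v; simp [ones]
      rw [this]
      exact measurable_pi_apply e (measurableSet_singleton 1))

/-- The level of a node of the tree. -/
def level : Ground d m → ℕ
  | Sum.inl (j, _, _) => j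
  | Sum.inr _ => d

variable [NeZero d]

/-- The probability that an element has value `1`. -/
noncomputable def rate (d : ℕ) : ℝ≥0∞ := (2 * d : ℝ≥0∞)⁻¹

lemma rate_mul (d : ℕ) [NeZero d] : rate d * d = 2⁻¹ := by
  have h : (d : ℝ≥0∞) ≠ 0 := by exact_mod_cast NeZero.ne d
  rw [rate, ENNReal.mul_inv (by simp) (by simp), mul_assoc,
    ENNReal.inv_mul_cancel h (by simp), mul_one]

lemma rate_ne_zero (d : ℕ) : rate d ≠ 0 := by
  rw [rate, Ne, ENNReal.inv_eq_zero]
  exact ENNReal.mul_ne_top (by simp) (by simp)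

lemma rate_lt_one (d : ℕ) [NeZero d] : rate d < 1 := by
  rw [rate, ENNReal.inv_lt_one]
  have h : 1 ≤ d := NeZero.one_le
  exact_mod_cast (by omega : 1 < 2 * d)

instance (d : ℕ) [NeZero d] : IsProbabilityMeasure (bernoulli (rate d)) :=
  isProbabilityMeasure_bernoulli (rate_lt_one d).le

/-- The instance whose feasible sets are the subsets of the root-to-leaf paths of the tree. -/
noncomputable def treeInstance (d m : ℕ) [NeZero d] : ProphetInstance (Ground d m) where
  dist _ := ⟨bernoulli (rate d), inferInstance⟩
  feasible := {S | ∃ y z, ∀ e ∈ S, ∃ j, e = node m j y z}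
  feasible_nonempty := ⟨∅, 0, 0, by simp⟩

lemma treeInstance_isBinary : (treeInstance d m).IsBinary := fun _ =>
  support_bernoulli (rate_ne_zero d) (rate_lt_one d)

lemma treeInstance_isDownwardClosed : (treeInstance d m).IsDownwardClosed := by
  rintro S ⟨y, z, h⟩ T hT
  exact ⟨y, z, fun e he => h e (hT he)⟩

lemma valueLaw_treeInstance :
    (treeInstance d m).valueLaw = Measure.pi fun _ => bernoulli (rate d) := rfl

instance : IsProbabilityMeasure (treeInstance d m).valueLaw := by
  rw [valueLaw_treeInstance]; infer_instance

lemma ae_valueLaw_le_one : ∀ᵐ v ∂(treeInstance d m).valueLaw, ∀ e, v e ≤ 1 := by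
  rw [ae_all_iff]
  intro e
  exact (measurePreserving_eval (fun _ => bernoulli (rate d)) e).quasiMeasurePreserving.ae
    bernoulli_ae

lemma lintegral_valueLaw_apply (e : Ground d m) :
    ∫⁻ v, (v e : ℝ≥0∞) ∂(treeInstance d m).valueLaw = rate d := by
  rw [← lintegral_bernoulli (p := rate d)]
  exact (measurePreserving_eval (fun _ => bernoulli (rate d)) e).lintegral_comp
    (f := fun x : ℝ≥0 => (x : ℝ≥0∞)) measurable_coe_nnreal_ennreal

/-! ### Upper bound for order-unaware algorithms -/

/-- The node at level `j` has all the hidden labels. -/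
def GoodAt (θ : Fin d → Fin d) (j : Fin d) (e : Ground d m) : Prop :=
  ∃ a c, e = node m j a c ∧ ∀ i ≤ j, c i = θ i

/-- The node is the first on its path without the hidden label. -/
def Frontier (θ : Fin d → Fin d) (e : Ground d m) : Prop :=
  ∃ j a c, e = node m j a c ∧ (∀ i < j, c i = θ i) ∧ c j ≠ θ j

/-- The node is late, and so is some descendant of it in `S`. -/
def Marked (θ : Fin d → Fin d) (S : Finset (Ground d m)) (e : Ground d m) : Prop :=
  ∃ e' ∈ S, ∃ j j' a c, j < j' ∧ e = node m j a c ∧ e' = node m j' a c ∧ Late θ e ∧ Late θ e'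

open Classical in
lemma sum_goodAt_add_frontier_add_late (θ : Fin d → Fin d)
    (j : Fin d) (a c : Fin d → Fin d) :
    1 ≤ (∑ i, if GoodAt θ i (node m j a c) then (1 : ℝ≥0∞) else 0) +
      (if Frontier θ (node m j a c) then 1 else 0) +
      (if Late θ (node m j a c) then 1 else 0) := by
  by_cases hl : Late θ (node m j a c)
  · simp [hl]
  have hl' : ∀ i < j, c i = θ i := by
    rw [late_node_iff] at hl; push Not at hl; exact hl
  by_cases hf : c j = θ j
  · have hg : GoodAt θ j (node m j a c) := by
      refine ⟨a, c, rfl, fun i hi => ?_⟩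
      rcases hi.lt_or_eq with hi | rfl
      · exact hl' i hi
      · exact hf
    have := Finset.single_le_sum (f := fun i => if GoodAt θ i (node m j a c) then (1 : ℝ≥0∞) else 0)
      (fun _ _ => zero_le) (Finset.mem_univ j)
    simp only [hg, if_true] at this
    exact this.trans (by rw [add_assoc]; exact le_self_add)
  · have : Frontier θ (node m j a c) := ⟨j, a, c, rfl, hl', hf⟩
    rw [if_pos this, add_right_comm]
    exact le_add_self

open Classical in
-- A path leaves the hidden labels for the first time only once.
lemma card_frontier_le_one (θ : Fin d → Fin d) {S : Finset (Ground d m)}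
    (hS : S ∈ (treeInstance d m).feasible) : (S.filter (Frontier θ)).card ≤ 1 := by
  obtain ⟨y, z, h⟩ := hS
  rw [Finset.card_le_one]
  intro e he f hf
  rw [Finset.mem_filter] at he hf
  obtain ⟨he, j, a, c, rfl, h1, h2⟩ := he
  obtain ⟨hf, j', a', c', rfl, h1', h2'⟩ := hf
  obtain ⟨i, hi⟩ := h _ he
  obtain ⟨i', hi'⟩ := h _ hf
  rw [hi, hi']
  rw [node_eq_iff] at hi hi'
  obtain ⟨rfl, hi⟩ := hi
  obtain ⟨rfl, hi'⟩ := hi'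
  rcases lt_trichotomy j j' with hlt | rfl | hlt
  · exact absurd (((hi j le_rfl).2.trans (hi' j hlt.le).2.symm).trans (h1' j hlt)) h2
  · rfl
  · exact absurd (((hi' j' le_rfl).2.trans (hi j' hlt.le).2.symm).trans (h1 j' hlt)) h2'

open Classical in
-- Of two late selected nodes on a path, the deeper one marks the shallower, so only the deepest can
-- be unmarked.
lemma card_late_not_marked_le_one (θ : Fin d → Fin d) {S : Finset (Ground d m)}
    (hS : S ∈ (treeInstance d m).feasible) :
    (S.filter fun e => Late θ e ∧ ¬ Marked θ S e).card ≤ 1 := by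
  obtain ⟨y, z, h⟩ := hS
  rw [Finset.card_le_one]
  intro e he f hf
  rw [Finset.mem_filter] at he hf
  obtain ⟨he, hle, hme⟩ := he
  obtain ⟨hf, hlf, hmf⟩ := hf
  obtain ⟨j, rfl⟩ := h _ he
  obtain ⟨j', rfl⟩ := h _ hf
  rcases lt_trichotomy j j' with hlt | rfl | hlt
  · exact absurd ⟨_, hf, j, j', y, z, hlt, rfl, rfl, hle, hlf⟩ hme
  · rfl
  · exact absurd ⟨_, he, j', j, y, z, hlt, rfl, rfl, hlf, hle⟩ hmf

open Classical in
-- Marked nodes are ancestors of selected ones, hence lie on the path containing `S`, one per level.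
lemma card_marked_le (θ : Fin d → Fin d) {S : Finset (Ground d m)}
    (hS : S ∈ (treeInstance d m).feasible) :
    (Finset.univ.filter (Marked θ S)).card ≤ d := by
  obtain ⟨y, z, h⟩ := hS
  have : Finset.univ.filter (Marked θ S) ⊆ Finset.univ.image fun j => node m j y z := by
    intro e he
    obtain ⟨e', he', j, j', a, c, hlt, rfl, rfl, -, -⟩ := (Finset.mem_filter.1 he).2
    obtain ⟨i, hi⟩ := h _ he'
    rw [node_eq_iff] at hi
    refine Finset.mem_image.2 ⟨j, Finset.mem_univ _, ?_⟩
    rw [node_eq_iff]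
    exact ⟨rfl, fun k hk =>
      ⟨(hi.2 k (hk.trans hlt.le)).1.symm, (hi.2 k (hk.trans hlt.le)).2.symm⟩⟩
  exact (Finset.card_le_card this).trans (Finset.card_image_le.trans (by simp))

open Classical in
-- Values are bounded by `1` except on marked nodes, where the actual value is kept so that its
-- small mean can be used later. The `2` counts the frontier node and the deepest late node.
lemma sum_value_le (θ : Fin d → Fin d) {S : Finset (Ground d m)}
    (hS : S ∈ (treeInstance d m).feasible) {v : Ground d m → ℝ≥0} (hv : ∀ e, v e ≤ 1) :
    ∑ e ∈ S, (v e : ℝ≥0∞) ≤ (∑ j, ((S.filter (GoodAt θ j)).card : ℝ≥0∞)) + 2 +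
      ∑ e, (if Marked θ S e then 1 else 0) * (v e : ℝ≥0∞) := by
  have hle : ∀ e ∈ S, (v e : ℝ≥0∞) ≤ (∑ j, if GoodAt θ j e then (1 : ℝ≥0∞) else 0) +
      (if Frontier θ e then 1 else 0) + (if Late θ e ∧ ¬ Marked θ S e then 1 else 0) +
      (if Marked θ S e then 1 else 0) * (v e : ℝ≥0∞) := by
    intro e he
    by_cases hm : Marked θ S e
    · simp [hm]
    · obtain ⟨y, z, h⟩ := hS
      obtain ⟨j, rfl⟩ := h e he
      have h1 : (v (node m j y z) : ℝ≥0∞) ≤ 1 := by exact_mod_cast hv _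
      refine h1.trans ((sum_goodAt_add_frontier_add_late (m := m) θ j y z).trans ?_)
      simp only [hm, not_false_eq_true, and_true]
      exact le_self_add
  refine (Finset.sum_le_sum hle).trans ?_
  rw [Finset.sum_add_distrib, Finset.sum_add_distrib, Finset.sum_add_distrib, Finset.sum_comm]
  refine add_le_add ?_ (Finset.sum_le_univ_sum_of_nonneg fun _ => zero_le)
  simp only [Finset.sum_boole]
  rw [add_assoc]
  refine add_le_add le_rfl ?_
  rw [← one_add_one_eq_two]
  exact add_le_add (by exact_mod_cast card_frontier_le_one θ hS)
    (by exact_mod_cast card_late_not_marked_le_one θ hS)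

open Classical in
/-- An order-unaware algorithm guesses the hidden label of a level with probability `1 / d`. -/
lemma mul_sum_card_goodAt_le (A : OnlineAlgorithm (treeInstance d m)) (hA : A.IsOrderUnaware)
    (ω : A.Ω) (v : Ground d m → ℝ≥0) (j : Fin d) :
    d * ∑ θ, ((A.select (hiddenOrder m θ) ω v).filter (GoodAt θ j)).card ≤
      Fintype.card (Fin d → Fin d) := by
  -- It suffices to fix `θ` and resample its label at level `j`.
  rw [← sum_sum_update j fun θ => ((A.select (hiddenOrder m θ) ω v).filter (GoodAt θ j)).card,
    Fintype.card_eq_sum_ones]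
  refine Finset.sum_le_sum fun θ _ => ?_
  obtain ⟨y, z, h⟩ := A.feasible_select (hiddenOrder m θ) ω v
  have key : ∀ c e, e ∈ A.select (hiddenOrder m (Function.update θ j c)) ω v →
      GoodAt (Function.update θ j c) j e → e = node m j y z ∧ c = z j := by
    rintro c e he ⟨a, b, rfl, hb⟩
    have hnl : ¬ Late (Function.update θ j c) (node m j a b) := by
      rw [late_node_iff]; push Not; exact fun i hi => hb i hi.le
    have hag := hiddenOrder_agree (m := m) (θ := Function.update θ j c) (θ' := θ) (j := j)
      (fun i hi => Function.update_of_ne hi.ne _ _) hnl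
    -- The orders for `θ` and for its update agree up to this node, so its selection does not depend
    -- on `c`. It therefore lies on the one path containing the selection for `θ`, which forces `c =
    -- z j`.
    have hun := hA (hiddenOrder m (Function.update θ j c)) (hiddenOrder m θ) ω v _ hag
    rw [hag _ le_rfl] at hun
    rw [← hag _ le_rfl, Equiv.apply_symm_apply] at hun
    obtain ⟨i, hi⟩ := h _ (hun.1 he)
    change node m j a b = _ at hi
    rw [hi]
    rw [node_eq_iff] at hi
    obtain ⟨rfl, hi⟩ := hi
    refine ⟨rfl, ?_⟩
    have := hb j le_rfl
    rw [Function.update_self] at this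
    rw [← this, (hi j le_rfl).2]
  rw [Finset.sum_eq_single (z j)]
  · rw [Finset.card_le_one]
    intro e he f hf
    rw [Finset.mem_filter] at he hf
    rw [(key _ _ he.1 he.2).1, (key _ _ hf.1 hf.2).1]
  · intro c _ hc
    rw [Finset.card_eq_zero, Finset.filter_eq_empty_iff]
    intro e he hg
    exact hc (key c e he hg).2
  · simp

lemma measurableSet_marked (A : OnlineAlgorithm (treeInstance d m)) (π) (θ : Fin d → Fin d)
    (e : Ground d m) :
    MeasurableSet {p : A.Ω × (Ground d m → ℝ≥0) | Marked θ (A.select π p.1 p.2) e} := by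
  unfold Marked
  refine measurableSet_setOfPred.2 (Measurable.exists fun e' => Measurable.and ?_ measurable_const)
  exact measurableSet_setOfPred.1 (A.measurable_select π e')

/-- A marked element has a selected descendant that has arrived before it. -/
lemma marked_congr (A : OnlineAlgorithm (treeInstance d m)) (θ : Fin d → Fin d) (ω : A.Ω)
    {v v' : Ground d m → ℝ≥0} {e : Ground d m} (h : ∀ f, f ≠ e → v f = v' f)
    (hm : Marked θ (A.select (hiddenOrder m θ) ω v) e) :
    Marked θ (A.select (hiddenOrder m θ) ω v') e := by
  obtain ⟨e', he', j, j', a, c, hlt, rfl, rfl, hl, hl'⟩ := hm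
  refine ⟨_, ?_, j, j', a, c, hlt, rfl, rfl, hl, hl'⟩
  have hph : phase θ (node m j' a c) < phase θ (node m j a c) := by
    have h1 := phase_of_late hl
    have h2 := phase_of_late hl'
    rw [node, node, h1, h2]
    have := j'.2
    have : (j : ℕ) < j' := hlt
    omega
  have hlt' := hiddenOrder_symm_lt hph
  have := A.online (hiddenOrder m θ) ω v v' ((hiddenOrder m θ).symm (node m j' a c)) ?_
  · rw [Equiv.apply_symm_apply] at this
    exact this.1 he'
  · intro i hi
    refine h _ ?_
    rintro heq
    rw [← heq, Equiv.symm_apply_apply] at hlt'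
    exact absurd hi (not_le.2 hlt')

open Classical in
-- Being marked does not require being selected; it is settled by descendants that arrive earlier.
-- For a fixed seed it is therefore a function of the values other than that of `e`.
lemma lintegral_marked_mul (A : OnlineAlgorithm (treeInstance d m)) (θ : Fin d → Fin d)
    (e : Ground d m) :
    ∫⁻ p, (if Marked θ (A.select (hiddenOrder m θ) p.1 p.2) e then 1 else 0) * (p.2 e : ℝ≥0∞)
      ∂(A.μ.prod (treeInstance d m).valueLaw) =
    (∫⁻ p, (if Marked θ (A.select (hiddenOrder m θ) p.1 p.2) e then 1 else 0)
      ∂(A.μ.prod (treeInstance d m).valueLaw)) * rate d := by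
  have hmeas : Measurable fun p : A.Ω × (Ground d m → ℝ≥0) =>
      if Marked θ (A.select (hiddenOrder m θ) p.1 p.2) e then (1 : ℝ≥0∞) else 0 :=
    Measurable.ite (measurableSet_marked A _ θ e) measurable_const measurable_const
  have hval : Measurable fun v : Ground d m → ℝ≥0 => (v e : ℝ≥0∞) :=
    measurable_coe_nnreal_ennreal.comp (measurable_pi_apply e)
  have hmul : Measurable fun p : A.Ω × (Ground d m → ℝ≥0) =>
      (if Marked θ (A.select (hiddenOrder m θ) p.1 p.2) e then (1 : ℝ≥0∞) else 0) *
        (p.2 e : ℝ≥0∞) := hmeas.mul (hval.comp measurable_snd)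
  rw [lintegral_prod _ hmul.aemeasurable,
    lintegral_prod _ hmeas.aemeasurable, ← lintegral_mul_const _ hmeas.lintegral_prod_right']
  refine lintegral_congr fun ω => ?_
  rw [← lintegral_valueLaw_apply e, valueLaw_treeInstance]
  refine lintegral_pi_mul_of_dependsOn _ (Finset.univ.erase e) {e} (by simp)
    (hmeas.comp measurable_prodMk_left) hval ?_ ?_
  · intro v v' h
    have h1 : ∀ f, f ≠ e → v f = v' f := fun f hf => h f (by simpa using hf)
    have : Marked θ (A.select (hiddenOrder m θ) ω v) e ↔
        Marked θ (A.select (hiddenOrder m θ) ω v') e :=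
      ⟨marked_congr A θ ω h1, marked_congr A θ ω fun f hf => (h1 f hf).symm⟩
    simp only [this]
  · intro v v' h
    simp only [h e (by simp)]

open Classical in
lemma sum_lintegral_marked_le (A : OnlineAlgorithm (treeInstance d m)) (θ : Fin d → Fin d) :
    ∑ e, ∫⁻ p, (if Marked θ (A.select (hiddenOrder m θ) p.1 p.2) e then 1 else 0) * (p.2 e : ℝ≥0∞)
      ∂(A.μ.prod (treeInstance d m).valueLaw) ≤ 1 := by
  simp only [lintegral_marked_mul]
  rw [← Finset.sum_mul, ← lintegral_finsetSum _ fun e _ =>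
    Measurable.ite (measurableSet_marked A _ θ e) measurable_const measurable_const]
  have : ∫⁻ p, ∑ e, (if Marked θ (A.select (hiddenOrder m θ) p.1 p.2) e then 1 else 0)
      ∂(A.μ.prod (treeInstance d m).valueLaw) ≤
      ∫⁻ p, (d : ℝ≥0∞) ∂(A.μ.prod (treeInstance d m).valueLaw) := by
    refine lintegral_mono fun p => ?_
    rw [Finset.sum_boole]
    refine Nat.cast_le.2 ((Finset.card_le_card ?_).trans
      (card_marked_le θ (A.feasible_select (hiddenOrder m θ) p.1 p.2)))
    intro e
    simp
  refine (mul_le_mul_left this _).trans ?_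
  -- At most `d` marked nodes of mean `1 / (2d)` give `1 / 2`.
  rw [lintegral_const, measure_univ, mul_one, mul_comm, rate_mul]
  simp

/-- On average over the hidden labels, the utility of an order-unaware algorithm is at most `4`. -/
lemma sum_utility_le (A : OnlineAlgorithm (treeInstance d m)) (hA : A.IsOrderUnaware) :
    ∑ θ, A.utility (hiddenOrder m θ) ≤ ∑ _θ : Fin d → Fin d, 4 := by
  classical
  have hmk : ∀ θ e, Measurable fun p : A.Ω × (Ground d m → ℝ≥0) =>
      (if Marked θ (A.select (hiddenOrder m θ) p.1 p.2) e then (1 : ℝ≥0∞) else 0) *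
        (p.2 e : ℝ≥0∞) := fun θ e =>
    (Measurable.ite (measurableSet_marked A _ θ e) measurable_const measurable_const).mul
      (measurable_coe_nnreal_ennreal.comp ((measurable_pi_apply e).comp measurable_snd))
  have hcard : ∀ θ j, Measurable fun p : A.Ω × (Ground d m → ℝ≥0) =>
      (((A.select (hiddenOrder m θ) p.1 p.2).filter (GoodAt θ j)).card : ℝ≥0∞) := by
    intro θ j
    have : (fun p : A.Ω × (Ground d m → ℝ≥0) =>
        (((A.select (hiddenOrder m θ) p.1 p.2).filter (GoodAt θ j)).card : ℝ≥0∞)) =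
        fun p => ∑ e ∈ Finset.univ.filter (GoodAt θ j),
          if e ∈ A.select (hiddenOrder m θ) p.1 p.2 then (1 : ℝ≥0∞) else 0 := by
      funext p
      rw [Finset.sum_boole, Finset.filter_filter]
      congr 2
      ext e
      simp [and_comm]
    rw [this]
    exact Finset.measurable_sum _ fun e _ =>
      Measurable.ite (A.measurable_select _ e) measurable_const measurable_const
  have hae : ∀ᵐ p ∂(A.μ.prod (treeInstance d m).valueLaw), ∀ e, p.2 e ≤ 1 :=
    Measure.quasiMeasurePreserving_snd.ae ae_valueLaw_le_one
  have hθ : ∀ θ, A.utility (hiddenOrder m θ) ≤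
      (∫⁻ p, ∑ j, (((A.select (hiddenOrder m θ) p.1 p.2).filter (GoodAt θ j)).card : ℝ≥0∞)
        ∂(A.μ.prod (treeInstance d m).valueLaw)) + 3 := by
    intro θ
    have h1 : A.utility (hiddenOrder m θ) ≤
        ∫⁻ p, (∑ j, (((A.select (hiddenOrder m θ) p.1 p.2).filter (GoodAt θ j)).card : ℝ≥0∞)) +
          2 + ∑ e, (if Marked θ (A.select (hiddenOrder m θ) p.1 p.2) e then 1 else 0) *
            (p.2 e : ℝ≥0∞) ∂(A.μ.prod (treeInstance d m).valueLaw) :=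
      lintegral_mono_ae (hae.mono fun p hp => sum_value_le θ (A.feasible_select _ _ _) hp)
    refine h1.trans ?_
    rw [lintegral_add_right _ (Finset.measurable_sum _ fun e _ => hmk θ e),
      lintegral_add_right _ measurable_const, lintegral_finsetSum _ (fun e _ => hmk θ e),
      lintegral_const, measure_univ, mul_one, add_assoc]
    refine add_le_add le_rfl ?_
    calc _ ≤ (2 : ℝ≥0∞) + 1 := add_le_add le_rfl (sum_lintegral_marked_le A θ)
      _ = 3 := by norm_num
  refine (Finset.sum_le_sum fun θ _ => hθ θ).trans ?_
  rw [Finset.sum_add_distrib, ← lintegral_finsetSum _ fun θ _ =>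
    Finset.measurable_sum _ fun j _ => hcard θ j]
  have hpt : ∀ p : A.Ω × (Ground d m → ℝ≥0),
      ∑ θ, ∑ j, (((A.select (hiddenOrder m θ) p.1 p.2).filter (GoodAt θ j)).card : ℝ≥0∞) ≤
        Fintype.card (Fin d → Fin d) := by
    intro p
    -- Each of the `d` levels contributes a `1 / d` fraction of all `θ`, hence `1` on average in
    -- total.
    have hN : d * ∑ j, ∑ θ, ((A.select (hiddenOrder m θ) p.1 p.2).filter (GoodAt θ j)).card ≤
        d * Fintype.card (Fin d → Fin d) := by
      rw [Finset.mul_sum]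
      calc _ ≤ ∑ _j : Fin d, Fintype.card (Fin d → Fin d) :=
            Finset.sum_le_sum fun j _ => mul_sum_card_goodAt_le A hA p.1 p.2 j
        _ = _ := by simp
    have := Nat.le_of_mul_le_mul_left hN (Nat.pos_of_ne_zero (NeZero.ne d))
    rw [Finset.sum_comm]
    exact_mod_cast this
  refine (add_le_add (lintegral_mono hpt) le_rfl).trans ?_
  rw [lintegral_const, measure_univ, mul_one, Finset.sum_const, Finset.sum_const, Finset.card_univ,
    nsmul_eq_mul, nsmul_eq_mul]
  refine le_of_eq ?_
  ring

/-! ### Lower bound for the order-aware optimum -/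

lemma phase_node_hidden (θ : Fin d → Fin d) (j : Fin d) (x : Fin d → Fin d) :
    phase θ (node m j x θ) = j * d + x j := by
  have hl : ¬ Late θ (node m j x θ) := by rw [late_node_iff]; push Not; exact fun _ _ => rfl
  rw [node] at hl ⊢
  rw [phase_of_not_late hl]
  simp [trunc]

/-- The least label `a` for which the child with labels `a` and `θ j` of the node reached so far is
marked by `b`, or `0` if there is none. -/
noncomputable def choice (b : Ground d m → Bool) (θ : Fin d → Fin d) (j : Fin d)
    (x : Fin d → Fin d) : Fin d :=
  open Classical in
  if h : ∃ a, b (node m j (Function.update x j a) θ) then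
    wellFounded_lt.min {a | b (node m j (Function.update x j a) θ)} h else 0

lemma choice_spec {b : Ground d m → Bool} {θ : Fin d → Fin d} {j : Fin d} {x : Fin d → Fin d}
    (h : ∃ a, b (node m j (Function.update x j a) θ)) :
    b (node m j (Function.update x j (choice b θ j x)) θ) := by
  rw [choice, dif_pos h]
  exact wellFounded_lt.min_mem {a | b (node m j (Function.update x j a) θ)} h

lemma not_of_lt_choice {b : Ground d m → Bool} {θ : Fin d → Fin d} {j : Fin d} {x : Fin d → Fin d}
    {a : Fin d} (ha : a < choice b θ j x) : ¬ b (node m j (Function.update x j a) θ) := by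
  intro hb
  rw [choice, dif_pos ⟨a, hb⟩] at ha
  exact wellFounded_lt.not_lt_min {a | b (node m j (Function.update x j a) θ)} hb ha

lemma choice_eq {b : Ground d m → Bool} {θ : Fin d → Fin d} {j : Fin d} {x : Fin d → Fin d}
    {a : Fin d} (h : b (node m j (Function.update x j a) θ))
    (hlt : ∀ a' < a, ¬ b (node m j (Function.update x j a') θ)) : choice b θ j x = a := by
  rcases lt_trichotomy (choice b θ j x) a with h1 | h1 | h1
  · exact absurd (choice_spec ⟨a, h⟩) (hlt _ h1)
  · exact h1
  · exact absurd h (not_of_lt_choice h1)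

/-- The labels chosen on the first `k` levels. -/
noncomputable def walk (b : Ground d m → Bool) (θ : Fin d → Fin d) : ℕ → (Fin d → Fin d)
  | 0 => 0
  | k + 1 => if h : k < d then
      Function.update (walk b θ k) ⟨k, h⟩ (choice b θ ⟨k, h⟩ (walk b θ k)) else walk b θ k

lemma walk_succ (b : Ground d m → Bool) (θ : Fin d → Fin d) (j : Fin d) :
    walk b θ (j + 1) = Function.update (walk b θ j) j (choice b θ j (walk b θ j)) := by
  simp [walk]

lemma walk_apply_of_le (b : Ground d m → Bool) (θ : Fin d → Fin d) {k l : ℕ} (hkl : k ≤ l)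
    (i : Fin d) (hi : (i : ℕ) < k) : walk b θ l i = walk b θ k i := by
  induction l, hkl using Nat.le_induction with
  | base => rfl
  | succ l hl ih =>
    rw [← ih, walk]
    split_ifs with h
    · exact Function.update_of_ne (by rw [Ne, Fin.ext_iff]; simp only; omega) _ _
    · rfl

lemma node_walk (b : Ground d m → Bool) (θ : Fin d → Fin d) (j : Fin d) :
    node m j (walk b θ d) θ = node m j (walk b θ (j + 1)) θ := by
  rw [node_eq_iff]
  exact ⟨rfl, fun i hi => ⟨walk_apply_of_le b θ j.2 i (Nat.lt_succ_of_le hi), rfl⟩⟩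

/-- The first `k` steps read only the levels below `k`. This serves both the online property and the
independence of successive levels. -/
lemma walk_congr {b b' : Ground d m → Bool} {θ : Fin d → Fin d} {k : ℕ}
    (h : ∀ i : Fin d, (i : ℕ) < k → ∀ x, b (node m i x θ) = b' (node m i x θ)) :
    walk b θ k = walk b' θ k := by
  induction k with
  | zero => rfl
  | succ k ih =>
    have ih := ih fun i hi => h i (hi.trans (Nat.lt_succ_self k))
    rw [walk, walk, ih]
    split_ifs with hk
    · have : choice b θ ⟨k, hk⟩ (walk b' θ k) = choice b' θ ⟨k, hk⟩ (walk b' θ k) := by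
        simp only [choice, h ⟨k, hk⟩ (Nat.lt_succ_self k)]
      rw [this]
    · rfl

open Classical in
/-- The marked nodes on the path that is chosen. -/
noncomputable def collect (b : Ground d m → Bool) (θ : Fin d → Fin d) : Finset (Ground d m) :=
  Finset.univ.filter fun e => b e ∧ ∃ j, e = node m j (walk b θ d) θ

/-- Collecting a node of level `j` requires the walk above it, read off earlier levels, and the
absence of a `1` at smaller labels `a`, whose phases are smaller. Larger labels are irrelevant,
since the choice is the least one. -/
lemma collect_online {b b' : Ground d m → Bool} {θ : Fin d → Fin d} {e : Ground d m}
    (h : ∀ f, arrivalKey θ f ≤ arrivalKey θ e → b f = b' f) (he : e ∈ collect b θ) :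
    e ∈ collect b' θ := by
  rw [collect, Finset.mem_filter] at he ⊢
  obtain ⟨-, hbe, j, rfl⟩ := he
  refine ⟨Finset.mem_univ _, (h _ le_rfl) ▸ hbe, j, ?_⟩
  rw [node_walk] at h hbe ⊢
  rw [node_walk]
  have hph : phase θ (node m j (walk b θ (j + 1)) θ) = j * d + choice b θ j (walk b θ j) := by
    rw [phase_node_hidden, walk_succ, Function.update_self]
  have hw : walk b θ j = walk b' θ j := by
    refine walk_congr fun i hi x => h _ (arrivalKey_le_of_phase_lt ?_)
    rw [phase_node_hidden, hph]
    have := (x i).2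
    nlinarith
  have hc : choice b' θ j (walk b θ j) = choice b θ j (walk b θ j) := by
    refine choice_eq ?_ fun a ha => ?_
    · rw [← walk_succ, ← h _ le_rfl]
      exact hbe
    · rw [← h _ (arrivalKey_le_of_phase_lt ?_)]
      · exact not_of_lt_choice ha
      · rw [phase_node_hidden, hph, Function.update_self]
        have : (a : ℕ) < choice b θ j (walk b θ j) := ha
        omega
  rw [walk_succ, walk_succ, ← hw, hc]

lemma collect_feasible (b : Ground d m → Bool) (θ : Fin d → Fin d) :
    collect b θ ∈ (treeInstance d m).feasible :=
  ⟨walk b θ d, θ, fun _ he => (Finset.mem_filter.1 he).2.2⟩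

open Classical in
/-- The order-aware algorithm for the order with hidden labels `θ`. -/
noncomputable def awareAlgorithm (m : ℕ) (θ : Fin d → Fin d) :
    OnlineAlgorithm (treeInstance d m) where
  Ω := Unit
  μ := Measure.dirac ()
  -- Only the utility for this one order matters; for any other order the empty set is a feasible
  -- default.
  select π _ v := if π = hiddenOrder m θ then collect (ones v) θ else ∅
  measurable_select π e := by
    by_cases h : π = hiddenOrder m θ
    · simp only [h, if_true]
      exact (measurable_ones.comp measurable_snd) (MeasurableSet.of_discrete (s := {b | e ∈ collect b θ}))
    · simp [h]
  feasible_select π ω v := by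
    split_ifs
    · exact collect_feasible _ _
    · exact ⟨0, 0, by simp⟩
  online π ω v v' t h := by
    by_cases hπ : π = hiddenOrder m θ
    · simp only [hπ, if_true]
      subst hπ
      have h' : ∀ f, arrivalKey θ f ≤ arrivalKey θ (hiddenOrder m θ t) → ones v f = ones v' f := by
        intro f hf
        have := h ((hiddenOrder m θ).symm f) (by
          rw [← Equiv.symm_apply_apply (hiddenOrder m θ) t, hiddenOrder, keyOrder_symm_le_iff]
          exact hf)
        rw [Equiv.apply_symm_apply] at this
        simp only [ones, this]
      exact ⟨collect_online h', collect_online fun f hf => (h' f hf).symm⟩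
    · simp [hπ]

open Classical in
-- Each level with a candidate of value `1` contributes its own collected node.
lemma sum_hit_le (v : Ground d m → ℝ≥0) (θ : Fin d → Fin d) :
    ∑ j : Fin d, (if ∃ a, ones v (node m j (Function.update (walk (ones v) θ j) j a) θ)
      then (1 : ℝ≥0∞) else 0) ≤ ∑ e ∈ collect (ones v) θ, (v e : ℝ≥0∞) := by
  have h1 : ∑ e ∈ collect (ones v) θ, (v e : ℝ≥0∞) = ((collect (ones v) θ).card : ℝ≥0∞) := by
    rw [Finset.card_eq_sum_ones, Nat.cast_sum]
    refine Finset.sum_congr rfl fun e he => ?_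
    have := (Finset.mem_filter.1 he).2.1
    simp only [ones, decide_eq_true_eq] at this
    simp [this]
  rw [h1, Finset.sum_boole]
  refine Nat.cast_le.2 (Finset.card_le_card_of_injOn (fun j => node m j (walk (ones v) θ d) θ) ?_ ?_)
  · intro j hj
    have hj := (Finset.mem_filter.1 hj).2
    refine Finset.mem_coe.2 (Finset.mem_filter.2 ⟨Finset.mem_univ _, ?_, j, rfl⟩)
    change ones v (node m j (walk (ones v) θ d) θ) = true
    rw [node_walk, walk_succ]
    exact choice_spec hj
  · intro i _ j _ h
    exact (node_eq_iff.1 h).1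

lemma one_sub_rate_pow_le (d : ℕ) [NeZero d] : (1 - rate d) ^ d ≤ 1 - 3⁻¹ := by
  have hd : (0 : ℝ) < d := by exact_mod_cast Nat.pos_of_ne_zero (NeZero.ne d)
  have hr : rate d = ENNReal.ofReal (1 / (2 * d)) := by
    rw [rate, one_div, ENNReal.ofReal_inv_of_pos (by positivity), ENNReal.ofReal_mul (by norm_num)]
    simp
  set u : ℝ := 1 / (2 * d) with hu
  have hu0 : 0 < u := by positivity
  have hdu : d * u = 1 / 2 := by rw [hu]; field_simp
  have hd1 : (1 : ℝ) ≤ d := by exact_mod_cast (NeZero.one_le : 1 ≤ d)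
  have hu1 : u ≤ 1 := by nlinarith
  have h3 : (1 : ℝ≥0∞) - 3⁻¹ = ENNReal.ofReal (1 - 3⁻¹) := by
    rw [ENNReal.ofReal_sub _ (by norm_num), ENNReal.ofReal_inv_of_pos (by norm_num)]
    simp
  rw [hr, h3, ← ENNReal.ofReal_one, ← ENNReal.ofReal_sub _ hu0.le,
    ← ENNReal.ofReal_pow (by linarith)]
  refine ENNReal.ofReal_le_ofReal ?_
  -- Bernoulli's inequality gives `(1 + u) ^ d ≥ 3 / 2`, and `(1 - u) ^ d` is at most its inverse,
  -- `2 / 3`.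
  have hb : 1 + d * u ≤ (1 + u) ^ d := one_add_mul_le_pow (by linarith) d
  have hm : (1 - u) ^ d * (1 + u) ^ d ≤ 1 := by
    rw [← mul_pow]
    exact pow_le_one₀ (by nlinarith) (by nlinarith)
  have hp : 0 ≤ (1 - u) ^ d := pow_nonneg (by linarith) d
  rw [hdu] at hb
  nlinarith

open Classical in
/-- Among the `d` children that have the hidden label, some value is `1` with probability at least
`1 / 3`. -/
lemma third_le_lintegral_hit (θ : Fin d → Fin d) (j : Fin d) (x : Fin d → Fin d) :
    3⁻¹ ≤ ∫⁻ v, (if ∃ a, ones v (node m j (Function.update x j a) θ) then (1 : ℝ≥0∞) else 0)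
      ∂(treeInstance d m).valueLaw := by
  let f : Fin d → Ground d m := fun a => node m j (Function.update x j a) θ
  have hf : Function.Injective f := by
    intro a a' h
    have := ((node_eq_iff.1 h).2 j le_rfl).1
    simpa using this
  -- The event that no candidate has value `1` is a box, so its measure is a product.
  have hset : {v : Ground d m → ℝ≥0 | ∃ a, ones v (f a)}ᶜ =
      Set.univ.pi fun e => if e ∈ Finset.univ.image f then ({1}ᶜ : Set ℝ≥0) else Set.univ := by
    ext v
    simp only [ones, Set.mem_compl_iff, Set.mem_ofPred_eq, decide_eq_true_eq, not_exists,
      Set.mem_univ_pi]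
    constructor
    · intro h e
      split_ifs with he
      · obtain ⟨a, -, rfl⟩ := Finset.mem_image.1 he
        exact h a
      · exact Set.mem_univ _
    · intro h a
      have := h (f a)
      rw [if_pos (Finset.mem_image_of_mem f (Finset.mem_univ a))] at this
      exact this
  have hmeas : MeasurableSet {v : Ground d m → ℝ≥0 | ∃ a, ones v (f a)} :=
    measurable_ones (MeasurableSet.of_discrete (s := {b : Ground d m → Bool | ∃ a, b (f a) = true}))
  have hmu : (treeInstance d m).valueLaw {v : Ground d m → ℝ≥0 | ∃ a, ones v (f a)}ᶜ =
      (1 - rate d) ^ d := by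
    rw [hset, valueLaw_treeInstance, Measure.pi_pi]
    have : ∀ e : Ground d m, bernoulli (rate d)
        (if e ∈ Finset.univ.image f then ({1}ᶜ : Set ℝ≥0) else Set.univ) =
        if e ∈ Finset.univ.image f then 1 - rate d else 1 := by
      intro e
      split_ifs
      · exact bernoulli_compl_one
      · exact measure_univ
    simp only [this]
    rw [Finset.prod_ite_mem, Finset.univ_inter, Finset.prod_const, Finset.card_image_of_injective _ hf]
    simp
  have hind : ∀ v : Ground d m → ℝ≥0, (if ∃ a, ones v (f a) then (1 : ℝ≥0∞) else 0) =
      Set.indicator {v : Ground d m → ℝ≥0 | ∃ a, ones v (f a)} 1 v := by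
    intro v
    simp [Set.indicator_apply]
  change _ ≤ ∫⁻ v, (if ∃ a, ones v (f a) then (1 : ℝ≥0∞) else 0) ∂_
  simp only [hind]
  rw [lintegral_indicator_one hmeas]
  have hcompl := prob_compl_eq_one_sub (μ := (treeInstance d m).valueLaw) hmeas.compl
  rw [compl_compl, hmu] at hcompl
  rw [hcompl]
  have h3 : (3⁻¹ : ℝ≥0∞) ≤ 1 := by simp
  calc (3⁻¹ : ℝ≥0∞) = 1 - (1 - 3⁻¹) := (ENNReal.sub_sub_cancel (by simp) h3).symm
    _ ≤ _ := tsub_le_tsub_left (one_sub_rate_pow_le d) 1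

open Classical in
-- The walk so far depends only on levels above `j` in the tree, so conditioning on its value leaves
-- the candidates of level `j` unbiased and the bound for a fixed `x` applies.
lemma third_le_lintegral_hit_walk (θ : Fin d → Fin d) (j : Fin d) :
    3⁻¹ ≤ ∫⁻ v, (if ∃ a, ones v (node m j (Function.update (walk (ones v) θ j) j a) θ)
      then (1 : ℝ≥0∞) else 0) ∂(treeInstance d m).valueLaw := by
  have hmeasW : ∀ x, Measurable fun v : Ground d m → ℝ≥0 =>
      if walk (ones v) θ j = x then (1 : ℝ≥0∞) else 0 := fun x =>
    (Measurable.of_discrete (f := fun b : Ground d m → Bool =>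
      if walk b θ j = x then (1 : ℝ≥0∞) else 0)).comp measurable_ones
  have hmeasH : ∀ x : Fin d → Fin d, Measurable fun v : Ground d m → ℝ≥0 =>
      if ∃ a, ones v (node m j (Function.update x j a) θ) then (1 : ℝ≥0∞) else 0 := fun x =>
    (Measurable.of_discrete (f := fun b : Ground d m → Bool =>
      if ∃ a, b (node m j (Function.update x j a) θ) then (1 : ℝ≥0∞) else 0)).comp measurable_ones
  have hsplit : ∀ v : Ground d m → ℝ≥0,
      (if ∃ a, ones v (node m j (Function.update (walk (ones v) θ j) j a) θ)
        then (1 : ℝ≥0∞) else 0) =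
      ∑ x, (if walk (ones v) θ j = x then (1 : ℝ≥0∞) else 0) *
        (if ∃ a, ones v (node m j (Function.update x j a) θ) then (1 : ℝ≥0∞) else 0) := by
    intro v
    rw [Finset.sum_eq_single (walk (ones v) θ j)]
    · simp
    · intro x _ hx
      simp [hx.symm]
    · simp
  simp only [hsplit]
  have hmul : ∀ x : Fin d → Fin d, Measurable fun v : Ground d m → ℝ≥0 =>
      (if walk (ones v) θ j = x then (1 : ℝ≥0∞) else 0) *
        (if ∃ a, ones v (node m j (Function.update x j a) θ) then (1 : ℝ≥0∞) else 0) :=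
    fun x => (hmeasW x).mul (hmeasH x)
  rw [lintegral_finsetSum _ fun x _ => hmul x]
  have hone : ∑ x, ∫⁻ v, (if walk (ones v) θ j = x then (1 : ℝ≥0∞) else 0)
      ∂(treeInstance d m).valueLaw = 1 := by
    rw [← lintegral_finsetSum _ fun x _ => hmeasW x]
    simp
  calc (3⁻¹ : ℝ≥0∞) = ∑ x, (∫⁻ v, (if walk (ones v) θ j = x then (1 : ℝ≥0∞) else 0)
      ∂(treeInstance d m).valueLaw) * 3⁻¹ := by rw [← Finset.sum_mul, hone, one_mul]
    _ ≤ _ := Finset.sum_le_sum fun x _ => ?_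
  refine (mul_le_mul_right (third_le_lintegral_hit (m := m) θ j x) _).trans (le_of_eq ?_)
  rw [valueLaw_treeInstance]
  refine (lintegral_pi_mul_of_dependsOn _ (Finset.univ.filter fun e => level e < j)
    (Finset.univ.filter fun e => level e = j) ?_ (hmeasW x) (hmeasH x) ?_ ?_).symm
  · rw [Finset.disjoint_filter]
    exact fun e _ h => h.ne
  · intro v v' h
    have : walk (ones v) θ j = walk (ones v') θ j := by
      refine walk_congr fun i hi y => ?_
      simp only [ones]
      rw [h (node m i y θ) (Finset.mem_coe.2 (Finset.mem_filter.2 ⟨Finset.mem_univ _, hi⟩))]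
    simp only [this]
  · intro v v' h
    have : ∀ a, ones v (node m j (Function.update x j a) θ) =
        ones v' (node m j (Function.update x j a) θ) := by
      intro a
      simp only [ones]
      rw [h (node m j (Function.update x j a) θ)
        (Finset.mem_coe.2 (Finset.mem_filter.2 ⟨Finset.mem_univ _, rfl⟩))]
    simp only [this]

lemma lintegral_dirac_prod_snd {X : Type*} [MeasurableSpace X] {ν : Measure X}
    [IsProbabilityMeasure ν] {f : X → ℝ≥0∞} (hf : Measurable f) :
    ∫⁻ p : Unit × X, f p.2 ∂((Measure.dirac ()).prod ν) = ∫⁻ x, f x ∂ν :=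
  measurePreserving_snd.lintegral_comp hf

lemma le_opt_hiddenOrder (θ : Fin d → Fin d) :
    (d : ℝ≥0∞) * 3⁻¹ ≤ (treeInstance d m).opt (hiddenOrder m θ) := by
  classical
  refine le_trans ?_ (le_iSup (fun A : OnlineAlgorithm (treeInstance d m) =>
    A.utility (hiddenOrder m θ)) (awareAlgorithm m θ))
  have hmeas : ∀ j : Fin d, Measurable fun v : Ground d m → ℝ≥0 =>
      if ∃ a, ones v (node m j (Function.update (walk (ones v) θ j) j a) θ)
        then (1 : ℝ≥0∞) else 0 := fun j =>
    (Measurable.of_discrete (f := fun b : Ground d m → Bool =>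
      if ∃ a, b (node m j (Function.update (walk b θ j) j a) θ)
        then (1 : ℝ≥0∞) else 0)).comp measurable_ones
  calc (d : ℝ≥0∞) * 3⁻¹ = ∑ _j : Fin d, 3⁻¹ := by simp
    _ ≤ ∑ j : Fin d, ∫⁻ v,
        (if ∃ a, ones v (node m j (Function.update (walk (ones v) θ j) j a) θ)
          then (1 : ℝ≥0∞) else 0) ∂(treeInstance d m).valueLaw :=
      Finset.sum_le_sum fun j _ => third_le_lintegral_hit_walk θ j
    _ = ∫⁻ v, ∑ j : Fin d,
        (if ∃ a, ones v (node m j (Function.update (walk (ones v) θ j) j a) θ)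
          then (1 : ℝ≥0∞) else 0) ∂(treeInstance d m).valueLaw :=
      (lintegral_finsetSum _ fun j _ => hmeas j).symm
    _ = ∫⁻ p : Unit × (Ground d m → ℝ≥0), ∑ j : Fin d,
        (if ∃ a, ones p.2 (node m j (Function.update (walk (ones p.2) θ j) j a) θ)
          then (1 : ℝ≥0∞) else 0) ∂((Measure.dirac ()).prod (treeInstance d m).valueLaw) :=
      (lintegral_dirac_prod_snd (Finset.measurable_sum _ fun j _ => hmeas j)).symm
    _ ≤ (awareAlgorithm m θ).utility (hiddenOrder m θ) := by
      refine lintegral_mono fun p => ?_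
      simp only [awareAlgorithm, if_true]
      exact sum_hit_le p.2 θ

/-! ### Positivity of the optimum and the ratio `12 / d` -/

/-- The algorithm that selects one node of the tree whatever its value is. -/
noncomputable def selectRoot (d m : ℕ) [NeZero d] : OnlineAlgorithm (treeInstance d m) where
  Ω := Unit
  μ := Measure.dirac ()
  select _ _ _ := {node m 0 0 0}
  measurable_select _ _ := by simp
  feasible_select _ _ _ := ⟨0, 0, fun _ he => ⟨0, Finset.mem_singleton.1 he⟩⟩
  online _ _ _ _ _ _ := Iff.rfl

lemma opt_pos (π : ArrivalOrder (Ground d m)) : 0 < (treeInstance d m).opt π := by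
  refine lt_of_lt_of_le ?_ (le_iSup (fun A : OnlineAlgorithm (treeInstance d m) =>
    A.utility π) (selectRoot d m))
  have hval : Measurable fun v : Ground d m → ℝ≥0 => (v (node m 0 0 0) : ℝ≥0∞) :=
    measurable_coe_nnreal_ennreal.comp (measurable_pi_apply _)
  have : (selectRoot d m).utility π = rate d := by
    rw [← lintegral_valueLaw_apply (node m 0 0 0)]
    simp only [OnlineAlgorithm.utility, selectRoot, Finset.sum_singleton]
    exact lintegral_dirac_prod_snd hval
  rw [this]
  exact pos_iff_ne_zero.2 (rate_ne_zero d)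

lemma orderCompetitiveRatio_le (A : OnlineAlgorithm (treeInstance d m)) (hA : A.IsOrderUnaware) :
    A.orderCompetitiveRatio ≤ ENNReal.ofReal (12 / d) := by
  -- Some order does no better than the average over `θ`.
  obtain ⟨θ, hθ⟩ : ∃ θ, A.utility (hiddenOrder m θ) ≤ 4 := by
    by_contra! hcon
    exact absurd (sum_utility_le A hA) (not_le.2
      (ENNReal.sum_lt_sum_of_nonempty Finset.univ_nonempty fun θ _ => hcon θ))
  have hd : (0 : ℝ) < d := by exact_mod_cast Nat.pos_of_ne_zero (NeZero.ne d)
  refine (iInf_le _ (hiddenOrder m θ)).trans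
    ((ENNReal.div_le_div hθ (le_opt_hiddenOrder θ)).trans (le_of_eq ?_))
  have h1 : (d : ℝ≥0∞) * 3⁻¹ = ENNReal.ofReal (d * 3⁻¹) := by
    rw [ENNReal.ofReal_mul hd.le, ENNReal.ofReal_inv_of_pos (by norm_num)]
    simp
  have h4 : (4 : ℝ≥0∞) = ENNReal.ofReal 4 := by simp
  rw [h1, h4, ← ENNReal.ofReal_div_of_pos (by positivity)]
  congr 1
  field_simp
  norm_num

lemma card_ground {d m : ℕ} : Fintype.card (Ground d m) = d * (d ^ d * d ^ d) + m := by
  simp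

/-! ### Depth of the tree as a function of `n` -/

/-- A depth `d` for which the tree fits into `n` elements and `d` is at least of the order of
`log n / log log n`. -/
lemma exists_depth {n : ℕ} (hn : 2 < n) :
    ∃ d : ℕ, d ≠ 0 ∧ d * (d ^ d * d ^ d) ≤ n ∧
      (12 : ℝ) / d ≤ 600 * Real.log (Real.log n) / Real.log n := by
  have hn3 : (3 : ℝ) ≤ n := by exact_mod_cast hn
  have hn0 : (0 : ℝ) < n := by linarith
  set L := Real.log n with hL
  have hL3 : Real.log 3 ≤ L := Real.log_le_log (by norm_num) hn3
  have hlog3 : (1.09 : ℝ) ≤ Real.log 3 := by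
    have := Real.log_three_gt_d9
    linarith
  have hL0 : 0 < L := by linarith
  rcases lt_or_ge L (Real.exp 1) with hlt | hge
  -- For small `n`, `log log n` is close to `0`. Here `log L ≥ 1 - 1 / 1.09 ≥ 0.08` and `L < e`, so
  -- `12 * L < 600 * 0.08`; this case is why the constant is as large as `600`.
  · refine ⟨1, one_ne_zero, by simp; omega, ?_⟩
    have h1 : 1 - L⁻¹ ≤ Real.log L := Real.one_sub_inv_le_log_of_pos hL0
    have h2 : L⁻¹ ≤ (1.09 : ℝ)⁻¹ := inv_anti₀ (by norm_num) (by linarith)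
    have h3 : (1.09 : ℝ)⁻¹ ≤ 0.92 := by norm_num
    have h4 := Real.exp_one_lt_d9
    rw [le_div_iff₀ hL0, Nat.cast_one]
    nlinarith
  · have hlogL : 1 ≤ Real.log L := by
      rw [← Real.log_exp 1]
      exact Real.log_le_log (Real.exp_pos 1) hge
    -- The logarithm of `d * (d ^ d * d ^ d)` is at most `3 * d * log d`, and `log d ≤ log L`, so
    -- any `d ≤ q` fits. Rounding down loses at most a factor `2`.
    set q : ℝ := L / (3 * Real.log L) with hq
    have hq0 : 0 < q := by positivity
    have hqL : q * (3 * Real.log L) = L := by rw [hq]; field_simp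
    have hfin : ∀ d : ℕ, d ≠ 0 → q ≤ 2 * d → (12 : ℝ) / d ≤ 600 * Real.log L / L := by
      intro d hd hqd
      have hd0 : (0 : ℝ) < d := by exact_mod_cast Nat.pos_of_ne_zero hd
      rw [div_le_div_iff₀ hd0 hL0]
      nlinarith
    rcases lt_or_ge q 1 with hq1 | hq1
    · exact ⟨1, one_ne_zero, by simp; omega, hfin 1 one_ne_zero (by push_cast; linarith)⟩
    · have hfl := Nat.floor_le hq0.le
      have hfl' := Nat.lt_floor_add_one q
      have hd1 : 1 ≤ ⌊q⌋₊ := Nat.one_le_floor_iff q |>.2 hq1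
      have hd1' : (1 : ℝ) ≤ (⌊q⌋₊ : ℝ) := by exact_mod_cast hd1
      refine ⟨⌊q⌋₊, by omega, ?_, hfin _ (by omega) (by linarith)⟩
      set d := ⌊q⌋₊ with hd
      have hdL : (d : ℝ) ≤ L := by nlinarith
      have hlogd : Real.log d ≤ Real.log L := Real.log_le_log (by linarith) hdL
      have hlogd0 : 0 ≤ Real.log d := Real.log_nonneg hd1'
      have hpow : ((d * (d ^ d * d ^ d) : ℕ) : ℝ) ≤ n := by
        push_cast
        have hpos : (0 : ℝ) < d := by linarith
        rw [← Real.log_le_log_iff (by positivity) hn0,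
          Real.log_mul (by positivity) (by positivity),
          Real.log_mul (by positivity) (by positivity), Real.log_pow, ← hL]
        calc Real.log d + (d * Real.log d + d * Real.log d)
            ≤ d * Real.log d + (d * Real.log d + d * Real.log d) := by nlinarith
          _ = 3 * d * Real.log d := by ring
          _ ≤ 3 * d * Real.log L := by gcongr
          _ ≤ 3 * q * Real.log L := by gcongr
          _ = L := by linarith
      exact_mod_cast hpow

end HiddenTree

theorem theorem3p1 :
    ∃ ξ : ℝ, 0 < ξ ∧ ∀ n : ℕ, 2 < n →
      ∃ (E : Type) (_ : Fintype E) (I : ProphetInstance E),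
        Fintype.card E = n ∧ I.IsBinary ∧ I.IsDownwardClosed ∧
        (∀ π : ArrivalOrder E, 0 < I.opt π) ∧
        ∀ A : OnlineAlgorithm I, A.IsOrderUnaware →
          A.orderCompetitiveRatio ≤
            ENNReal.ofReal (ξ * Real.log (Real.log (n : ℝ)) / Real.log (n : ℝ)) := by
  refine ⟨600, by norm_num, fun n hn => ?_⟩
  obtain ⟨d, hd, hcard, hlog⟩ := HiddenTree.exists_depth hn
  have : NeZero d := ⟨hd⟩
  refine ⟨HiddenTree.Ground d (n - d * (d ^ d * d ^ d)), inferInstance,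
    HiddenTree.treeInstance d _, ?_, HiddenTree.treeInstance_isBinary,
    HiddenTree.treeInstance_isDownwardClosed, HiddenTree.opt_pos, fun A hA => ?_⟩
  · rw [HiddenTree.card_ground]
    omega
  · exact (HiddenTree.orderCompetitiveRatio_le A hA).trans (ENNReal.ofReal_le_ofReal hlog)
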